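/- Let $X$ be a complex Banach space, let $T$ be a bounded linear operator on $X$, and let $N(\cdot)$ and $R(\cdot)$ denote null space and range. A bounded operator is \emph{upper semi-Fredholm} if its null space is finite-dimensional and its range is closed; its index is then $\operatorname{ind}(T)=\dim N(T)-\operatorname{codim}R(T)\in\mathbb Z\cup\{-\infty\}$. It is \emph{quasi-nilpotent} if its spectral radius is $0$. The operator $T$ is \emph{pseudo upper semi B-Fredholm} if $X=X_1\oplus X_2$ for some closed $T$-invariant subspaces $X_1,X_2$ such that $T|_{X_1}$ is upper semi-Fredholm and $T|_{X_2}$ is quasi-nilpotent. If these can be chosen so that moreover $\operatorname{ind}(T|_{X_1})\le 0$, we write $T\in pBuW(X)$. Let $H_0(T)=\{x\in X:\lim_{n\to\infty}\|T^nx\|^{1/n}=0\}$. The operator $T$ is \emph{left generalized Drazin invertible} if $H_0(T)$ is closed and there is a closed $T$-invariant subspace $M$ of $X$ such that $X=H_0(T)\oplus M$ and $T(M)$ is closed. Let $\sigma_{lgD}(T)$, $\sigma_{pBuF}(T)$ and $\sigma_{pBuW}(T)$ be the sets of $\lambda\in\mathbb C$ for which $T-\lambda I$ is, respectively, not left generalized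 Drazin invertible, not pseudo upper semi B-Fredholm, and not in $pBuW(X)$. The operator $T$ has the \emph{single valued extension property (SVEP)} at $\lambda$ if for every connected open neighbourhood $U\subseteq\mathbb C$ of $\lambda$ the only analytic function $f:U\to X$ with $(T-zI)f(z)=0$ for all $z\in U$ is $f\equiv 0$. Let $S(T)$ be the set of all $\lambda\in\mathbb C$ at which $T$ fails to have the SVEP. Then $$\sigma_{lgD}(T)=\sigma_{pBuF}(T)\cup S(T)=\sigma_{pBuW}(T)\cup S(T).$$ -/

import Mathlib

open Set Filter Topology

noncomputable section

namespace PseudoBFredholm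

variable {X : Type*} [NormedAddCommGroup X] [NormedSpace ℂ X]

/-- `T` has the single valued extension property (SVEP) at `l`.
The open neighbourhoods are connected, as in the standard definition with open discs. -/
def HasSVEPAt (T : X →L[ℂ] X) (l : ℂ) : Prop :=
  ∀ U : Set ℂ, IsOpen U → IsConnected U → l ∈ U →
    ∀ f : ℂ → X, AnalyticOnNhd ℂ f U → (∀ z ∈ U, T (f z) - z • f z = 0) → ∀ z ∈ U, f z = 0

/-- The set `S(T)` of points where `T` fails to have the SVEP. -/
def svepFailureSet (T : X →L[ℂ] X) : Set ℂ := {l | ¬ HasSVEPAt T l}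

/-- Finite-dimensional null space and closed range. -/
def IsUpperSemiFredholm (T : X →L[ℂ] X) : Prop :=
  FiniteDimensional ℂ (LinearMap.ker T.toLinearMap) ∧ IsClosed (Set.range T)

/-- `dim N(T)` as an extended natural number. -/
def nullity (T : X →L[ℂ] X) : ℕ∞ :=
  Cardinal.toENat (Module.rank ℂ (LinearMap.ker T.toLinearMap))

/-- `codim R(T)` as an extended natural number. -/
def defect (T : X →L[ℂ] X) : ℕ∞ :=
  Cardinal.toENat (Module.rank ℂ (X ⧸ LinearMap.range T.toLinearMap))

/-- The index `dim N(T) - codim R(T)`, with values in `[-∞, ∞]`; it is meaningful for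
semi-Fredholm operators, where the two dimensions are not both infinite. -/
def index (T : X →L[ℂ] X) : EReal :=
  ((nullity T : ENNReal) : EReal) - ((defect T : ENNReal) : EReal)

/-- Quasi-nilpotent: the spectral radius vanishes. On the zero space the spectrum is empty and
the only operator is quasi-nilpotent. -/
def IsQuasinilpotent (T : X →L[ℂ] X) : Prop := spectralRadius ℂ T = 0

/-- `T = T₁ ⊕ T₂` with respect to a decomposition of the space as a direct sum of two closed
`T`-invariant subspaces, with `T₁` upper semi-Fredholm and `T₂` quasi-nilpotent. -/
def IsPseudoUpperSemiBFredholm (T : X →L[ℂ] X) : Prop :=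
  ∃ (X₁ X₂ : Submodule ℂ X) (h₁ : MapsTo T X₁ X₁) (h₂ : MapsTo T X₂ X₂),
    IsClosed (X₁ : Set X) ∧ IsClosed (X₂ : Set X) ∧ IsCompl X₁ X₂ ∧
      IsUpperSemiFredholm (T.restrict h₁) ∧ IsQuasinilpotent (T.restrict h₂)

/-- The class `pBuW(X)`: as above, with `T₁` upper semi-Fredholm of index `≤ 0`. -/
def IsPseudoUpperSemiBWeyl (T : X →L[ℂ] X) : Prop :=
  ∃ (X₁ X₂ : Submodule ℂ X) (h₁ : MapsTo T X₁ X₁) (h₂ : MapsTo T X₂ X₂),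
    IsClosed (X₁ : Set X) ∧ IsClosed (X₂ : Set X) ∧ IsCompl X₁ X₂ ∧
      IsUpperSemiFredholm (T.restrict h₁) ∧ index (T.restrict h₁) ≤ 0 ∧
      IsQuasinilpotent (T.restrict h₂)

/-- The quasi-nilpotent part `H₀(T) = {x | lim ‖Tⁿ x‖^(1/n) = 0}`. -/
def quasinilpotentPart (T : X →L[ℂ] X) : Submodule ℂ X where
  carrier := {x | Tendsto (fun n : ℕ => ‖(T ^ n) x‖ ^ (1 / (n : ℝ))) atTop (𝓝 0)}
  zero_mem' := by
    refine tendsto_const_nhds.congr' ?_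
    filter_upwards [eventually_ge_atTop 1] with n hn
    have : (1 / (n : ℝ)) ≠ 0 := by positivity
    simp [Real.zero_rpow (by simpa using this : ((n : ℝ)⁻¹) ≠ 0)]
  add_mem' := by
    intro x y hx hy
    have h := Tendsto.add hx hy
    rw [add_zero] at h
    refine squeeze_zero' (Eventually.of_forall fun n => by positivity) ?_ h
    filter_upwards [eventually_ge_atTop 1] with n hn
    have hn' : (1 : ℝ) ≤ n := by exact_mod_cast hn
    rw [map_add]
    refine (Real.rpow_le_rpow (norm_nonneg _) (norm_add_le _ _) (by positivity)).trans ?_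
    exact Real.rpow_add_le_add_rpow (norm_nonneg _) (norm_nonneg _) (by positivity)
      ((div_le_one (by linarith)).2 hn')
  smul_mem' := by
    intro c x hx
    have h := Tendsto.const_mul (max 1 ‖c‖) hx
    rw [mul_zero] at h
    refine squeeze_zero' (Eventually.of_forall fun n => by positivity) ?_ h
    filter_upwards [eventually_ge_atTop 1] with n hn
    have hn' : (1 : ℝ) ≤ n := by exact_mod_cast hn
    rw [map_smul, norm_smul, Real.mul_rpow (norm_nonneg _) (norm_nonneg _)]
    refine mul_le_mul_of_nonneg_right ?_ (by positivity)
    refine (Real.rpow_le_rpow (norm_nonneg _) (le_max_right 1 ‖c‖) (by positivity)).trans ?_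
    refine (Real.rpow_le_rpow_of_exponent_le (le_max_left 1 ‖c‖)
      ((div_le_one (by linarith)).2 hn')).trans ?_
    rw [Real.rpow_one]

/-- `H₀(T)` is closed and has a closed `T`-invariant complement `M` such that `T(M)` is closed. -/
def IsLeftGeneralizedDrazinInvertible (T : X →L[ℂ] X) : Prop :=
  IsClosed (quasinilpotentPart T : Set X) ∧
    ∃ M : Submodule ℂ X, MapsTo T M M ∧ IsClosed (M : Set X) ∧
      IsCompl (quasinilpotentPart T) M ∧ IsClosed (T '' M)

/-- `σ_lgD(T)`. -/
def leftGeneralizedDrazinSpectrum (T : X →L[ℂ] X) : Set ℂ :=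
  {l | ¬ IsLeftGeneralizedDrazinInvertible (T - l • ContinuousLinearMap.id ℂ X)}

/-- `σ_pBuF(T)`. -/
def pseudoUpperSemiBFredholmSpectrum (T : X →L[ℂ] X) : Set ℂ :=
  {l | ¬ IsPseudoUpperSemiBFredholm (T - l • ContinuousLinearMap.id ℂ X)}

/-- `σ_pBuW(T)`. -/
def pseudoUpperSemiBWeylSpectrum (T : X →L[ℂ] X) : Set ℂ :=
  {l | ¬ IsPseudoUpperSemiBWeyl (T - l • ContinuousLinearMap.id ℂ X)}

end PseudoBFredholm

end

namespace PseudoBFredholm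

/-! After translation take `λ = 0`; since pBuW implies pBuF, two implications suffice. If `X = H₀(T)
⊕ M` as in left generalized Drazin invertibility, `T` is injective on `M` with closed range, hence
bounded below there and of index at most 0, while `T` on the closed subspace `H₀(T)` is
quasi-nilpotent by uniform boundedness. For small `z ≠ 0` the operator `T - z` is injective on both
summands, which gives SVEP at 0. Conversely, let `T = T₁ ⊕ T₂` with `T₁` upper semi-Fredholm, `T₂`
quasi-nilpotent and SVEP at 0. A nonzero kernel vector of `T₁` lying in every `R(T₁ⁿ)` would start a
backward orbit whose power series violates SVEP (`not_hasSVEPAt_zero_of_surjOn`), so `N(T₁) ∩ R(T₁ⁿ)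
= 0` for some `n`. Then finitely many Jordan chains split off (`exists_nilpotent_projection`),
leaving an injective part with closed range. The nilpotent part and `X₂` together form `H₀(T)`, and
the injective part is the complement `M`. -/

/-! ### Root growth of orbits and the quasi-nilpotent part. -/

theorem tendsto_root_zero_of_le_mul {a b : ℕ → ℝ} (C : ℝ) (ha : ∀ n, 0 ≤ a n)
    (hb : ∀ n, 0 ≤ b n) (hab : ∀ n, a n ≤ C * b n)
    (h : Tendsto (fun n : ℕ => b n ^ (1 / (n : ℝ))) atTop (𝓝 0)) :
    Tendsto (fun n : ℕ => a n ^ (1 / (n : ℝ))) atTop (𝓝 0) := by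
  -- With a constant at least 1, its `n`-th root is bounded by the constant itself.
  have h' := Tendsto.const_mul (max 1 C) h
  rw [mul_zero] at h'
  have hC : 0 ≤ max 1 C := zero_le_one.trans (le_max_left 1 C)
  refine squeeze_zero' (Eventually.of_forall fun n => Real.rpow_nonneg (ha n) _) ?_ h'
  filter_upwards [eventually_ge_atTop 1] with n hn
  have hn' : (1 : ℝ) ≤ n := by exact_mod_cast hn
  have h1 : a n ≤ max 1 C * b n :=
    (hab n).trans (mul_le_mul_of_nonneg_right (le_max_right 1 C) (hb n))
  refine (Real.rpow_le_rpow (ha n) h1 (by positivity)).trans ?_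
  rw [Real.mul_rpow hC (hb n)]
  refine mul_le_mul_of_nonneg_right ?_ (Real.rpow_nonneg (hb n) _)
  refine (Real.rpow_le_rpow_of_exponent_le (le_max_left 1 C)
    ((div_le_one (by linarith)).2 hn')).trans ?_
  rw [Real.rpow_one]

variable {X Y : Type*} [NormedAddCommGroup X] [NormedSpace ℂ X]
  [NormedAddCommGroup Y] [NormedSpace ℂ Y]

theorem mem_quasinilpotentPart {T : X →L[ℂ] X} {x : X} :
    x ∈ quasinilpotentPart T ↔
      Tendsto (fun n : ℕ => ‖(T ^ n) x‖ ^ (1 / (n : ℝ))) atTop (𝓝 0) := Iff.rfl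

theorem intertwine_pow {T : X →L[ℂ] X} {T' : Y →L[ℂ] Y} {S : X →L[ℂ] Y}
    (h : ∀ x, S (T x) = T' (S x)) (n : ℕ) (x : X) : S ((T ^ n) x) = (T' ^ n) (S x) := by
  induction n generalizing x with
  | zero => simp
  | succ n ih => rw [pow_succ, pow_succ, mul_apply_eq_comp,
      mul_apply_eq_comp, ih, h]

theorem map_mem_quasinilpotentPart {T : X →L[ℂ] X} {T' : Y →L[ℂ] Y} (S : X →L[ℂ] Y)
    (h : ∀ x, S (T x) = T' (S x)) {x : X} (hx : x ∈ quasinilpotentPart T) :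
    S x ∈ quasinilpotentPart T' := by
  refine tendsto_root_zero_of_le_mul ‖S‖ (fun _ => norm_nonneg _) (fun _ => norm_nonneg _)
    (fun n => ?_) hx
  rw [← intertwine_pow h]
  exact S.le_opNorm _

theorem eq_zero_of_mem_quasinilpotentPart {T : X →L[ℂ] X} {x : X} {c : ℝ} (hc : 0 < c)
    (h : ∀ n, c ^ n * ‖x‖ ≤ ‖(T ^ n) x‖) (hx : x ∈ quasinilpotentPart T) : x = 0 := by
  by_contra hx0
  have hpos : 0 < ‖x‖ := norm_pos_iff.2 hx0
  have h0 : Tendsto (fun n : ℕ => (c ^ n) ^ (1 / (n : ℝ))) atTop (𝓝 0) := by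
    refine tendsto_root_zero_of_le_mul ‖x‖⁻¹ (fun n => by positivity) (fun _ => norm_nonneg _)
      (fun n => ?_) hx
    rw [← div_eq_inv_mul, le_div_iff₀ hpos]
    exact h n
  have h1 : Tendsto (fun n : ℕ => (c ^ n) ^ (1 / (n : ℝ))) atTop (𝓝 c) := by
    refine tendsto_const_nhds.congr' ?_
    filter_upwards [eventually_ge_atTop 1] with n hn
    rw [one_div, Real.pow_rpow_inv_natCast hc.le (by omega)]
  exact hc.ne' (tendsto_nhds_unique h1 h0)

theorem eq_zero_of_eigenvector {T : X →L[ℂ] X} {x : X} {z : ℂ} (hz : z ≠ 0)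
    (h : T x = z • x) (hx : x ∈ quasinilpotentPart T) : x = 0 := by
  refine eq_zero_of_mem_quasinilpotentPart (norm_pos_iff.2 hz) (fun n => ?_) hx
  have : (T ^ n) x = z ^ n • x := by
    induction n with
    | zero => simp
    | succ n ih => rw [pow_succ, mul_apply_eq_comp, h, map_smul, ih, smul_smul,
        pow_succ, mul_comm]
  rw [this, norm_smul, norm_pow]

theorem eq_zero_of_bounded_below {T : X →L[ℂ] X} {M : Submodule ℂ X} (hM : MapsTo T M M)
    {c : ℝ} (hc : 0 < c) (h : ∀ x ∈ M, c * ‖x‖ ≤ ‖T x‖) {x : X} (hxM : x ∈ M)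
    (hx : x ∈ quasinilpotentPart T) : x = 0 := by
  refine eq_zero_of_mem_quasinilpotentPart hc (fun n => ?_) hx
  clear hx
  induction n generalizing x with
  | zero => simp
  | succ n ih =>
    rw [pow_succ, pow_succ, mul_apply_eq_comp, mul_assoc]
    exact (mul_le_mul_of_nonneg_left (h x hxM) (by positivity)).trans (ih (hM hxM))

/-- Local decay becomes uniform by Banach–Steinhaus: for `z ≠ 0` in the spectrum and `ε = ‖z‖ / 2`,
the operators `ε⁻ⁿ Tⁿ` are pointwise, hence uniformly, bounded. As `zⁿ` lies in the spectrum of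
`Tⁿ`, this would bound `2ⁿ`. -/
theorem isQuasinilpotent_of_quasinilpotentPart [CompleteSpace X] {T : X →L[ℂ] X}
    (h : ∀ x, x ∈ quasinilpotentPart T) : IsQuasinilpotent T := by
  have key : ∀ z ∈ spectrum ℂ T, z = 0 := by
    intro z hz
    by_contra hz0
    have hzpos : 0 < ‖z‖ := norm_pos_iff.2 hz0
    set ε : ℝ := ‖z‖ / 2 with hε
    have hεpos : 0 < ε := by positivity
    obtain ⟨C, hC⟩ := banach_steinhaus (g := fun n : ℕ => ((ε⁻¹ : ℝ) : ℂ) ^ n • T ^ n) (by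
      intro x
      have hb : BddAbove (range fun n : ℕ => ‖(((ε⁻¹ : ℝ) : ℂ) ^ n • T ^ n) x‖) := by
        refine IsBoundedUnder.bddAbove_range ⟨1, ?_⟩
        rw [eventually_map]
        filter_upwards [(mem_quasinilpotentPart.1 (h x)).eventually (gt_mem_nhds hεpos),
          eventually_ge_atTop 1] with n hn hn1
        have h1 : ‖(T ^ n) x‖ ≤ ε ^ n := by
          have := pow_le_pow_left₀ (Real.rpow_nonneg (norm_nonneg _) _) hn.le n
          rwa [one_div, Real.rpow_inv_natCast_pow (norm_nonneg _) (by omega)] at this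
        rw [smul_apply, norm_smul, norm_pow, Complex.norm_real,
          Real.norm_of_nonneg (by positivity), inv_pow, inv_mul_le_iff₀ (by positivity), mul_one]
        exact h1
      obtain ⟨C, hC⟩ := hb
      exact ⟨C, fun n => hC (mem_range_self n)⟩)
    have h2 : ∀ n : ℕ, (2 : ℝ) ^ n ≤ C * ‖(1 : X →L[ℂ] X)‖ := by
      intro n
      have h3 := spectrum.norm_le_norm_mul_of_mem (spectrum.pow_mem_pow T n hz)
      have h4 := hC n
      rw [norm_smul, norm_pow, Complex.norm_real, Real.norm_of_nonneg (by positivity), inv_pow,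
        inv_mul_le_iff₀ (by positivity)] at h4
      have h5 : ‖z‖ ^ n ≤ ε ^ n * C * ‖(1 : X →L[ℂ] X)‖ := by
        rw [← norm_pow]
        exact h3.trans (mul_le_mul_of_nonneg_right h4 (norm_nonneg _))
      have h6 : ‖z‖ = ε * 2 := by rw [hε]; ring
      rw [h6, mul_pow, mul_assoc] at h5
      exact le_of_mul_le_mul_left h5 (by positivity)
    obtain ⟨n, hn⟩ := pow_unbounded_of_one_lt (C * ‖(1 : X →L[ℂ] X)‖) (one_lt_two (α := ℝ))
    exact absurd (h2 n) (not_le.2 hn)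
  refine le_antisymm (iSup₂_le fun z hz => ?_) bot_le
  simp [key z hz]

theorem mem_quasinilpotentPart_of_isQuasinilpotent [CompleteSpace X] {T : X →L[ℂ] X}
    (h : IsQuasinilpotent T) (x : X) : x ∈ quasinilpotentPart T := by
  have h1 := spectrum.pow_norm_pow_one_div_tendsto_nhds_spectralRadius T
  rw [show spectralRadius ℂ T = 0 from h] at h1
  have h2 := (ENNReal.tendsto_toReal ENNReal.zero_ne_top).comp h1
  refine tendsto_root_zero_of_le_mul (b := fun n => ‖T ^ n‖) ‖x‖ (fun _ => norm_nonneg _)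
    (fun _ => norm_nonneg _) (fun n => ?_) ?_
  · rw [mul_comm]
    exact (T ^ n).le_opNorm x
  · refine h2.congr fun n => ?_
    exact ENNReal.toReal_ofReal (Real.rpow_nonneg (norm_nonneg _) _)

theorem restrict_coe {T : X →L[ℂ] X} {M : Submodule ℂ X} (hM : MapsTo T M M) (x : M) :
    ((T.restrict hM x : M) : X) = T x := rfl

theorem coe_restrict_pow {T : X →L[ℂ] X} {M : Submodule ℂ X} (hM : MapsTo T M M) (n : ℕ)
    (x : M) : (((T.restrict hM ^ n) x : M) : X) = (T ^ n) x :=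
  intertwine_pow (T := T.restrict hM) (T' := T) (S := M.subtypeL) (restrict_coe hM) n x

theorem isQuasinilpotent_restrict [CompleteSpace X] {T : X →L[ℂ] X} {M : Submodule ℂ X}
    (hM : MapsTo T M M) (hcl : IsClosed (M : Set X)) (hle : M ≤ quasinilpotentPart T) :
    IsQuasinilpotent (T.restrict hM) := by
  have := hcl.completeSpace_coe
  refine isQuasinilpotent_of_quasinilpotentPart fun x => ?_
  refine (mem_quasinilpotentPart.1 (hle x.2)).congr fun n => ?_
  rw [← coe_restrict_pow hM, Submodule.coe_norm]

theorem exists_bounded_below [CompleteSpace X] {T : X →L[ℂ] X} {M : Submodule ℂ X}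
    (hcl : IsClosed (M : Set X)) (hinj : ∀ x ∈ M, T x = 0 → x = 0) (hr : IsClosed (T '' M)) :
    ∃ c : ℝ, 0 < c ∧ ∀ x ∈ M, c * ‖x‖ ≤ ‖T x‖ := by
  have := hcl.completeSpace_coe
  have hr' : IsClosed (range (T.comp M.subtypeL)) := by
    convert hr using 1
    ext y
    simp
  obtain ⟨K, hK⟩ := (T.comp M.subtypeL).antilipschitz_of_injective_of_isClosed_range
    ((injective_iff_map_eq_zero _).2 fun x hx => Subtype.ext (hinj x x.2 hx)) hr'
  -- `K` may be 0, hence the shift by 1.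
  refine ⟨(K + 1 : ℝ)⁻¹, by positivity, fun x hx => ?_⟩
  have h := ZeroHomClass.bound_of_antilipschitz _ hK ⟨x, hx⟩
  rw [inv_mul_le_iff₀ (by positivity)]
  refine h.trans ?_
  change (K : ℝ) * ‖T x‖ ≤ _
  nlinarith [norm_nonneg (T x)]

theorem hasSVEPAt_zero_translate {T : X →L[ℂ] X} {l : ℂ} (h : HasSVEPAt T l) :
    HasSVEPAt (T - l • ContinuousLinearMap.id ℂ X) 0 := by
  intro U hU hc h0 f hf hTf z hz
  have hV : (Homeomorph.addRight l) '' U = (fun w => w - l) ⁻¹' U := by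
    ext w
    simp [sub_eq_add_neg]
  have key := h ((fun w => w - l) ⁻¹' U) (hU.preimage (by fun_prop))
    (hV ▸ hc.image _ (Homeomorph.addRight l).continuous.continuousOn) (by simpa using h0)
    (fun w => f (w - l))
    (hf.comp (g := f) (f := fun w => w - l) (fun _ _ => by fun_prop) (fun _ hw => hw)) (by
      intro w hw
      have := hTf (w - l) hw
      simp only [sub_apply, smul_apply,
        ContinuousLinearMap.id_apply] at this
      rw [← this]
      module) (z + l) (by simpa using hz)
  simpa using key

theorem hasSVEPAt_of_translate {T : X →L[ℂ] X} {l : ℂ}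
    (h : HasSVEPAt (T - l • ContinuousLinearMap.id ℂ X) 0) : HasSVEPAt T l := by
  intro U hU hc h0 f hf hTf z hz
  have hV : (Homeomorph.addRight (-l)) '' U = (fun w => w + l) ⁻¹' U := by
    ext w
    simp
  have key := h ((fun w => w + l) ⁻¹' U) (hU.preimage (by fun_prop))
    (hV ▸ hc.image _ (Homeomorph.addRight (-l)).continuous.continuousOn) (by simpa using h0)
    (fun w => f (w + l))
    (hf.comp (g := f) (f := fun w => w + l) (fun _ _ => by fun_prop) (fun _ hw => hw)) (by
      intro w hw
      rw [← hTf (w + l) hw]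
      simp only [sub_apply, smul_apply,
        ContinuousLinearMap.id_apply]
      module) (z - l) (by simpa using hz)
  simpa using key

/-! ### Consequences of left generalized Drazin invertibility. -/

theorem IsLeftGeneralizedDrazinInvertible.injOn {T : X →L[ℂ] X} {M : Submodule ℂ X}
    (hc : IsCompl (quasinilpotentPart T) M) (x : X) (hx : x ∈ M) (hTx : T x = 0) : x = 0 := by
  refine Submodule.disjoint_def.1 hc.disjoint x ?_ hx
  refine tendsto_const_nhds.congr' ?_
  filter_upwards [eventually_ge_atTop 1] with n hn
  obtain ⟨m, rfl⟩ := Nat.exists_eq_add_of_le' hn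
  rw [pow_succ, mul_apply_eq_comp, hTx, map_zero, norm_zero, Real.zero_rpow]
  positivity

theorem quasinilpotentPart_mapsTo (T : X →L[ℂ] X) :
    MapsTo T (quasinilpotentPart T) (quasinilpotentPart T) :=
  fun _ hx => map_mem_quasinilpotentPart T (fun _ => rfl) hx

theorem IsLeftGeneralizedDrazinInvertible.isPseudoUpperSemiBWeyl [CompleteSpace X]
    {T : X →L[ℂ] X} (h : IsLeftGeneralizedDrazinInvertible T) : IsPseudoUpperSemiBWeyl T := by
  obtain ⟨hcl, M, hM, hMcl, hcompl, hTM⟩ := h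
  have hker : LinearMap.ker (T.restrict hM).toLinearMap = ⊥ := by
    refine (Submodule.eq_bot_iff _).2 fun x hx => Subtype.ext ?_
    exact injOn hcompl x x.2 (congrArg Subtype.val hx)
  refine ⟨M, quasinilpotentPart T, hM, quasinilpotentPart_mapsTo T, hMcl, hcl, hcompl.symm,
    ⟨?_, ?_⟩, ?_, ?_⟩
  · rw [hker]
    infer_instance
  · have hr : range (T.restrict hM) = Subtype.val ⁻¹' (T '' M) := by
      ext y
      constructor
      · rintro ⟨x, rfl⟩
        exact ⟨x, x.2, rfl⟩
      · rintro ⟨x, hx, hxy⟩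
        exact ⟨⟨x, hx⟩, Subtype.ext hxy⟩
    rw [hr]
    exact hTM.preimage continuous_subtype_val
  · have : nullity (T.restrict hM) = 0 := by
      rw [nullity, hker]
      simp
    rw [index, this]
    simpa using EReal.coe_ennreal_nonneg _
  · exact isQuasinilpotent_restrict _ hcl le_rfl

/-- For `0 < ‖z‖ < c`, with `c` the lower bound of `T` on `M`, an eigenvector for `z` has no
component in `M`, and `H₀(T)` contains no eigenvector for `z ≠ 0`. So `f` vanishes on a punctured
neighbourhood of 0, and the identity theorem on the connected set `U` finishes. -/
theorem IsLeftGeneralizedDrazinInvertible.hasSVEPAt_zero [CompleteSpace X]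
    {T : X →L[ℂ] X} (h : IsLeftGeneralizedDrazinInvertible T) : HasSVEPAt T 0 := by
  obtain ⟨hcl, M, hM, hMcl, hcompl, hTM⟩ := h
  obtain ⟨c, hc, hbd⟩ := exists_bounded_below hMcl (injOn hcompl) hTM
  intro U hU hUc h0 f hf hTf
  have key : ∀ z ∈ U, z ≠ 0 → ‖z‖ < c → f z = 0 := by
    intro z hz hz0 hzc
    have hTz : T (f z) = z • f z := sub_eq_zero.1 (hTf z hz)
    obtain ⟨a, ha, m, hm, ham⟩ := Submodule.mem_sup.1
      (hcompl.sup_eq_top.ge (Submodule.mem_top (x := f z)))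
    have h1 : T m - z • m = z • a - T a := by
      have : T a + T m = z • a + z • m := by rw [← map_add, ← smul_add, ham, hTz]
      rw [sub_eq_sub_iff_add_eq_add, add_comm, this]
    have h2 : T m - z • m = 0 := Submodule.disjoint_def.1 hcompl.disjoint _
      (h1 ▸ sub_mem (Submodule.smul_mem _ _ ha) (quasinilpotentPart_mapsTo T ha))
      (sub_mem (hM hm) (Submodule.smul_mem _ _ hm))
    have hm0 : m = 0 := by
      by_contra hne
      have h3 := hbd m hm
      rw [sub_eq_zero.1 h2, norm_smul] at h3
      exact absurd (le_of_mul_le_mul_right h3 (norm_pos_iff.2 hne)) (not_le.2 hzc)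
    rw [hm0, add_zero] at ham
    exact eq_zero_of_eigenvector hz0 hTz (ham ▸ ha)
  refine hf.eqOn_zero_of_preconnected_of_frequently_eq_zero hUc.isPreconnected h0 ?_
  refine Eventually.frequently ?_
  filter_upwards [self_mem_nhdsWithin, mem_nhdsWithin_of_mem_nhds (hU.mem_nhds h0),
    mem_nhdsWithin_of_mem_nhds (Metric.ball_mem_nhds (0 : ℂ) hc)] with z hz0 hz hzc
  exact key z hz hz0 (by simpa using hzc)

/-! ### Upper semi-Fredholm operators with SVEP at 0. -/

/-- `T` is a quotient map onto its closed range, and the preimage of `T(F)` is `F + N(T)`, closed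
because `N(T)` is finite-dimensional. -/
theorem IsUpperSemiFredholm.isClosed_map [CompleteSpace X] {T : X →L[ℂ] X}
    (h : IsUpperSemiFredholm T) {F : Submodule ℂ X} (hF : IsClosed (F : Set X)) :
    IsClosed (T '' F) := by
  have := h.1
  have hR : IsClosed ((LinearMap.range T.toLinearMap : Submodule ℂ X) : Set X) := by
    rw [LinearMap.coe_range]
    exact h.2
  have := hR.completeSpace_coe
  let T' : X →L[ℂ] LinearMap.range T.toLinearMap :=
    T.codRestrict _ fun x => LinearMap.mem_range_self T.toLinearMap x
  have hsurj : Function.Surjective T' := by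
    rintro ⟨_, x, rfl⟩
    exact ⟨x, rfl⟩
  have hpre : T' ⁻¹' (T' '' F) = ((F ⊔ LinearMap.ker T.toLinearMap : Submodule ℂ X) : Set X) := by
    ext x
    simp only [mem_preimage, mem_image, SetLike.mem_coe, Submodule.mem_sup]
    constructor
    · rintro ⟨y, hy, hxy⟩
      refine ⟨y, hy, x - y, ?_, by abel⟩
      have : T y = T x := congrArg Subtype.val hxy
      simp [this]
    · rintro ⟨y, hy, k, hk, rfl⟩
      refine ⟨y, hy, Subtype.ext ?_⟩
      have hk' : T k = 0 := hk
      change T y = T (y + k)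
      rw [map_add, hk', add_zero]
  have hcl : IsClosed (T' '' F) := by
    rw [← (T'.isQuotientMap hsurj).isClosed_preimage, hpre]
    exact Submodule.isClosed_sup_finiteDimensional _ _ hF
  have := hR.isClosedEmbedding_subtypeVal.isClosedMap _ hcl
  rwa [← image_comp] at this

theorem IsUpperSemiFredholm.isClosed_range_pow [CompleteSpace X] {T : X →L[ℂ] X}
    (h : IsUpperSemiFredholm T) (n : ℕ) :
    IsClosed ((LinearMap.range (T ^ n).toLinearMap : Submodule ℂ X) : Set X) := by
  induction n with
  | zero =>
    convert isClosed_univ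
    ext x
    simp
  | succ n ih =>
    convert h.isClosed_map ih using 1
    ext x
    simp [pow_succ']

/-- The open mapping theorem on `W` yields a backward orbit `T xₙ₊₁ = xₙ` of geometric growth; since
`T x₀ = 0`, the sum `∑ zⁿ xₙ` solves `(T - z) f(z) = 0` near 0, with `f(0) = x₀ ≠ 0`. -/
theorem not_hasSVEPAt_zero_of_surjOn [CompleteSpace X] {T : X →L[ℂ] X} {W : Submodule ℂ X}
    (hW : IsClosed (W : Set X)) (hTW : MapsTo T W W) (hsurj : SurjOn T W W) {x₀ : X}
    (hx₀ : x₀ ∈ W) (hne : x₀ ≠ 0) (hT : T x₀ = 0) : ¬ HasSVEPAt T 0 := by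
  intro hsvep
  have := hW.completeSpace_coe
  obtain ⟨C, hC, hCb⟩ := (T.restrict hTW).exists_preimage_norm_le (by
    rintro ⟨y, hy⟩
    obtain ⟨x, hx, hxy⟩ := hsurj hy
    exact ⟨⟨x, hx⟩, Subtype.ext hxy⟩)
  choose g hg hgn using hCb
  let x : ℕ → X := fun n => ((g^[n] ⟨x₀, hx₀⟩ : W) : X)
  have hx0 : x 0 = x₀ := rfl
  have hTx : ∀ n, T (x (n + 1)) = x n := fun n => by
    simp only [x, Function.iterate_succ_apply']
    exact congrArg Subtype.val (hg _)
  have hxn : ∀ n, ‖x n‖ ≤ C ^ n * ‖x₀‖ := by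
    intro n
    induction n with
    | zero => simp [hx0]
    | succ n ih =>
      have h1 : ‖x (n + 1)‖ ≤ C * ‖x n‖ := by
        simp only [x, Function.iterate_succ_apply']
        exact hgn _
      calc _ ≤ C * (C ^ n * ‖x₀‖) := h1.trans (mul_le_mul_of_nonneg_left ih hC.le)
        _ = _ := by ring
  -- This radius makes the `n`-th term at most `2⁻ⁿ ‖x₀‖`.
  let r : ℝ := (2 * C)⁻¹
  have hr : 0 < r := by positivity
  let u : ℕ → ℝ := fun n => (1 / 2) ^ n * ‖x₀‖
  have hu : Summable u := (summable_geometric_two).mul_right _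
  have hbound : ∀ n, ∀ z ∈ Metric.ball (0 : ℂ) r, ‖z ^ n • x n‖ ≤ u n := by
    intro n z hz
    rw [mem_ball_zero_iff] at hz
    rw [norm_smul, norm_pow]
    calc ‖z‖ ^ n * ‖x n‖ ≤ r ^ n * (C ^ n * ‖x₀‖) :=
          mul_le_mul (pow_le_pow_left₀ (norm_nonneg _) hz.le n) (hxn n) (norm_nonneg _)
            (by positivity)
      _ = (r * C) ^ n * ‖x₀‖ := by rw [mul_pow]; ring
      _ = u n := by
        have : r * C = 1 / 2 := by
          simp only [r]
          field_simp
        rw [this]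
  have hsum : ∀ z ∈ Metric.ball (0 : ℂ) r, Summable fun n => z ^ n • x n := fun z hz =>
    Summable.of_norm_bounded hu fun n => hbound n z hz
  have hdiff : DifferentiableOn ℂ (fun z : ℂ => ∑' n, z ^ n • x n) (Metric.ball 0 r) :=
    Complex.differentiableOn_tsum_of_summable_norm hu
      (fun n => by fun_prop) Metric.isOpen_ball hbound
  have h0 := hsvep (Metric.ball 0 r) Metric.isOpen_ball
    ⟨⟨0, Metric.mem_ball_self hr⟩, (convex_ball (0 : ℂ) r).isPreconnected⟩
    (Metric.mem_ball_self hr) _ (hdiff.analyticOnNhd Metric.isOpen_ball) (by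
      intro z hz
      have hs := hsum z hz
      rw [T.map_tsum hs, (T.summable hs).tsum_eq_zero_add, ← hs.tsum_const_smul]
      simp only [map_smul, hTx, hx0, hT, smul_zero, zero_add, smul_smul, pow_succ']
      exact sub_self _) 0 (Metric.mem_ball_self hr)
  refine hne ?_
  rw [← hx0, ← h0, tsum_eq_single 0]
  · simp
  · intro n hn
    simp [hn]

theorem pow_succ'_apply (T : X →L[ℂ] X) (n : ℕ) (x : X) : (T ^ (n + 1)) x = T ((T ^ n) x) := by
  rw [pow_succ', mul_apply_eq_comp]

theorem range_pow_antitone (T : X →L[ℂ] X) :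
    Antitone fun n : ℕ => LinearMap.range (T ^ n).toLinearMap := by
  refine antitone_nat_of_succ_le fun n => ?_
  rintro _ ⟨x, rfl⟩
  exact ⟨T x, by simp [pow_succ]⟩

/-- The subspaces `N(T) ∩ R(Tⁿ)` decrease in a finite-dimensional space, so they stabilize at some
`d`. A nonzero vector in the stable value lies in `W = ⋂ R(Tⁿ)`, which is closed and mapped onto
itself. -/
theorem IsUpperSemiFredholm.exists_ker_inf_range_pow_eq_bot [CompleteSpace X] {T : X →L[ℂ] X}
    (h : IsUpperSemiFredholm T) (hs : HasSVEPAt T 0) :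
    ∃ n : ℕ, ∀ x, T x = 0 → x ∈ LinearMap.range (T ^ n).toLinearMap → x = 0 := by
  have := h.1
  let D : ℕ →o (Submodule ℂ (LinearMap.ker T.toLinearMap))ᵒᵈ :=
    { toFun := fun n => OrderDual.toDual
        ((LinearMap.range (T ^ n).toLinearMap).comap (LinearMap.ker T.toLinearMap).subtype)
      monotone' := fun m n hmn => Submodule.comap_mono (range_pow_antitone T hmn) }
  obtain ⟨d, hd⟩ := IsArtinian.monotone_stabilizes D
  have hstab : ∀ x, T x = 0 → x ∈ LinearMap.range (T ^ d).toLinearMap →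
      ∀ n, x ∈ LinearMap.range (T ^ n).toLinearMap := by
    intro x hx hxd n
    rcases le_total d n with hdn | hnd
    · have h1 : (⟨x, hx⟩ : LinearMap.ker T.toLinearMap) ∈ OrderDual.ofDual (D d) := hxd
      rw [hd n hdn] at h1
      exact h1
    · exact range_pow_antitone T hnd hxd
  refine ⟨d, fun x₀ hTx₀ hx₀ => ?_⟩
  by_contra hne
  let W : Submodule ℂ X := ⨅ n : ℕ, LinearMap.range (T ^ n).toLinearMap
  have hWm : ∀ x, x ∈ W ↔ ∀ n, x ∈ LinearMap.range (T ^ n).toLinearMap := fun x =>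
    Submodule.mem_iInf _
  refine not_hasSVEPAt_zero_of_surjOn (W := W) ?_ ?_ ?_ ((hWm _).2 (hstab x₀ hTx₀ hx₀)) hne
    hTx₀ hs
  · rw [Submodule.coe_iInf]
    exact isClosed_iInter h.isClosed_range_pow
  · intro x hx
    refine (hWm _).2 fun n => ?_
    obtain ⟨y, rfl⟩ := (hWm x).1 hx n
    refine range_pow_antitone T n.le_succ ⟨y, ?_⟩
    simp [pow_succ']
  · intro y hy
    obtain ⟨v, hv⟩ := (hWm y).1 hy (d + 1)
    -- This preimage of `y` differs from one in `R(T ^ max d n)` by a kernel vector in `R(T ^ d)`,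
    -- which lies in all ranges by stability.
    refine ⟨(T ^ d) v, (hWm _).2 fun n => ?_, by rw [← pow_succ'_apply]; exact hv⟩
    refine range_pow_antitone T (le_max_right d n) ?_
    obtain ⟨w, hw⟩ := (hWm y).1 hy (max d n + 1)
    have h1 : T ((T ^ d) v - (T ^ max d n) w) = 0 := by
      have hv' : T ((T ^ d) v) = y := by rw [← pow_succ'_apply]; exact hv
      have hw' : T ((T ^ max d n) w) = y := by rw [← pow_succ'_apply]; exact hw
      rw [map_sub, hv', hw', sub_self]
    have h2 := hstab _ h1 (sub_mem ⟨v, rfl⟩ (range_pow_antitone T (le_max_left d n) ⟨w, rfl⟩))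
      (max d n)
    have h3 := add_mem h2 (⟨w, rfl⟩ : (T ^ max d n) w ∈ LinearMap.range (T ^ max d n).toLinearMap)
    simpa using h3

/-! ### Splitting off Jordan chains. -/

/-- A functional that vanishes on a closed subspace but not at a given point outside it. -/
theorem exists_functional {F : Submodule ℂ X} (hF : IsClosed (F : Set X)) {u : X} (hu : u ∉ F) :
    ∃ f : X →L[ℂ] ℂ, f u = 1 ∧ ∀ x ∈ F, f x = 0 := by
  obtain ⟨g, hg⟩ := SeparatingDual.exists_eq_one (R := ℂ)
    (x := (Submodule.Quotient.mk u : X ⧸ F)) (by simpa [Submodule.Quotient.mk_eq_zero] using hu)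
  refine ⟨g.comp F.mkQL, hg, fun x hx => ?_⟩
  have : F.mkQL x = 0 := (Submodule.Quotient.mk_eq_zero F).2 hx
  rw [ContinuousLinearMap.comp_apply, this, map_zero]

/-- Replace the top vector of a Jordan chain by one on which the functional `f` is dual to
the last vector of the chain. -/
theorem exists_dual_chain {T P : X →L[ℂ] X} (hTP : Commute T P) {f : X →L[ℂ] ℂ} {u : X}
    (hfu : f u = 1) {q : ℕ} (hTu : T u = 0) {x : X} (hx : (T ^ q) x = u) (hPx : P x = 0) :
    ∃ y, (T ^ q) y = u ∧ P y = 0 ∧ ∀ k < q, f ((T ^ k) y) = 0 := by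
  have hzero : ∀ y, (T ^ q) y = u → ∀ k, q < k → (T ^ k) y = 0 := by
    intro y hy k hk
    obtain ⟨m, rfl⟩ := Nat.exists_eq_add_of_lt hk
    rw [show q + m + 1 = m + 1 + q by ring, pow_add, mul_apply_eq_comp, hy, pow_succ,
      mul_apply_eq_comp, hTu, map_zero]
  have key : ∀ j ≤ q, ∃ y, (T ^ q) y = u ∧ P y = 0 ∧ ∀ k < q, q ≤ k + j → f ((T ^ k) y) = 0 := by
    intro j
    induction j with
    | zero => exact fun _ => ⟨x, hx, hPx, fun k hk hk' => by omega⟩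
    | succ j ih =>
      intro hj
      obtain ⟨y, hy, hPy, hfy⟩ := ih (by omega)
      have hcomp : ∀ k, (T ^ k) ((T ^ (j + 1)) y) = (T ^ (k + (j + 1))) y := fun k => by
        rw [pow_add _ k, mul_apply_eq_comp]
      -- The correction cancels the value at `k = q - (j + 1)` and leaves larger `k` alone, where `T
      -- ^ (k + j + 1) y = 0`.
      refine ⟨y - f ((T ^ (q - (j + 1))) y) • (T ^ (j + 1)) y, ?_, ?_, fun k hk hkj => ?_⟩
      · rw [map_sub, map_smul, hcomp, hzero y hy (q + (j + 1)) (by omega), smul_zero, sub_zero, hy]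
      · have : P ((T ^ (j + 1)) y) = (T ^ (j + 1)) (P y) :=
          congrArg (fun S : X →L[ℂ] X => S y) (hTP.pow_left (j + 1)).symm.eq
        rw [map_sub, map_smul, this, hPy, map_zero, smul_zero, sub_zero]
      · rw [map_sub, map_smul, hcomp, map_sub, map_smul]
        rcases Nat.lt_or_ge q (k + (j + 1)) with hlt | hge
        · rw [hzero y hy _ hlt, hfy k hk (by omega)]
          simp
        · have hk' : k + (j + 1) = q := by omega
          rw [hk', hy, hfu, show q - (j + 1) = k by omega]
          simp
  obtain ⟨y, hy, hPy, hfy⟩ := key q le_rfl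
  exact ⟨y, hy, hPy, fun k hk => hfy k hk (by omega)⟩

/-- The projection onto the span of a Jordan chain `y, T y, …, T ^ q y` given by a dual
functional `f`. -/
theorem exists_chain_projection {T P : X →L[ℂ] X} (hTP : Commute T P) {f : X →L[ℂ] ℂ} {q : ℕ}
    {y : X} (hTy : (T ^ (q + 1)) y = 0) (hPy : P y = 0) (hf1 : f ((T ^ q) y) = 1)
    (hf0 : ∀ k < q, f ((T ^ k) y) = 0) (hfT : ∀ x, f ((T ^ (q + 1)) x) = 0)
    (hfP : ∀ x, f (P x) = 0) :
    ∃ B : X →L[ℂ] X, B * B = B ∧ Commute T B ∧ T ^ (q + 1) * B = 0 ∧ B * P = 0 ∧ P * B = 0 ∧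
      B ((T ^ q) y) = (T ^ q) y := by
  let A : X →L[ℂ] X := f.smulRight y
  have hA : ∀ x, A x = f x • y := fun x => rfl
  -- By duality `f (T ^ k y)` is 1 for `k = q` and 0 otherwise, so `f (T ^ (q - i) x)` reads off the
  -- coefficient of `T ^ i y`.
  let B : X →L[ℂ] X := ∑ i ∈ Finset.range (q + 1), T ^ i * A * T ^ (q - i)
  have hB : ∀ x, B x = ∑ i ∈ Finset.range (q + 1), f ((T ^ (q - i)) x) • (T ^ i) y := by
    intro x
    simp [B, hA]
  have hpow : ∀ S : ℕ, ∀ x, P ((T ^ S) x) = (T ^ S) (P x) := fun S x =>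
    congrArg (fun R : X →L[ℂ] X => R x) (hTP.pow_left S).symm.eq
  have hvanish : ∀ k, q < k → (T ^ k) y = 0 := by
    intro k hk
    obtain ⟨m, rfl⟩ := Nat.exists_eq_add_of_le hk
    rw [show q.succ + m = m + (q + 1) by omega, pow_add, mul_apply_eq_comp, hTy,
      map_zero]
  have hfk : ∀ k, f ((T ^ k) y) = if k = q then 1 else 0 := by
    intro k
    rcases lt_trichotomy k q with h | h | h
    · rw [hf0 k h, if_neg h.ne]
    · rw [h, hf1, if_pos rfl]
    · rw [hvanish k h, map_zero, if_neg h.ne']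
  have hBT : ∀ j ≤ q, B ((T ^ j) y) = (T ^ j) y := by
    intro j hj
    rw [hB, Finset.sum_eq_single j]
    · rw [← mul_apply_eq_comp, ← pow_add, Nat.sub_add_cancel hj, hf1, one_smul]
    · intro i hi hij
      rw [Finset.mem_range] at hi
      rw [← mul_apply_eq_comp, ← pow_add, hfk, if_neg (by omega), zero_smul]
    · intro h
      exact absurd (Finset.mem_range.2 (by omega)) h
  refine ⟨B, ?_, ?_, ?_, ?_, ?_, hBT q le_rfl⟩
  · ext x
    rw [mul_apply_eq_comp, hB x, map_sum]
    refine Finset.sum_congr rfl fun i hi => ?_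
    rw [map_smul, hBT i (by rw [Finset.mem_range] at hi; omega)]
  -- `T * B` and `B * T` are the same sum shifted by one; the two end terms vanish by `hfT` and
  -- `hTy`.
  · let g : ℕ → (X →L[ℂ] X) := fun i => T ^ i * A * T ^ (q + 1 - i)
    have h1 : T * B = ∑ i ∈ Finset.range (q + 1), g (i + 1) := by
      rw [Finset.mul_sum]
      refine Finset.sum_congr rfl fun i hi => ?_
      simp only [g]
      rw [Nat.add_sub_add_right, pow_succ', mul_assoc, mul_assoc, mul_assoc]
    have h2 : B * T = ∑ i ∈ Finset.range (q + 1), g i := by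
      rw [Finset.sum_mul]
      refine Finset.sum_congr rfl fun i hi => ?_
      rw [Finset.mem_range] at hi
      simp only [g]
      rw [show q + 1 - i = q - i + 1 by omega, pow_succ, ← mul_assoc]
    have h3 : g 0 = 0 := by
      ext x
      simp only [g, pow_zero, one_mul, Nat.sub_zero, mul_apply_eq_comp, hA, hfT, zero_smul,
        zero_apply]
    have h4 : g (q + 1) = 0 := by
      ext x
      simp [g, hA, hTy]
    have h5 := Finset.sum_range_succ g (q + 1)
    rw [Finset.sum_range_succ', h3, h4, add_zero, add_zero] at h5
    exact h1.trans (h5.trans h2.symm)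
  · ext x
    rw [mul_apply_eq_comp, hB x, map_sum]
    refine Finset.sum_eq_zero fun i _ => ?_
    rw [map_smul, ← mul_apply_eq_comp, ← pow_add, hvanish _ (by omega), smul_zero]
  · ext x
    rw [mul_apply_eq_comp, hB]
    refine Finset.sum_eq_zero fun i _ => ?_
    rw [← hpow, hfP, zero_smul]
  · ext x
    rw [mul_apply_eq_comp, hB, map_sum]
    refine Finset.sum_eq_zero fun i _ => ?_
    rw [map_smul, hpow, hPy, map_zero, smul_zero]

/-- One Jordan chain of `T` on the kernel of `P` can be absorbed into the projection `P`. -/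
theorem exists_larger_projection {T P : X →L[ℂ] X}
    (hcl : ∀ n : ℕ, IsClosed ((LinearMap.range (T ^ n).toLinearMap : Submodule ℂ X) : Set X))
    (hasc : ∃ n : ℕ, ∀ x, T x = 0 → x ∈ LinearMap.range (T ^ n).toLinearMap → x = 0)
    (hP : P * P = P) (hTP : Commute T P) {n : ℕ} (hn : T ^ n * P = 0)
    (hne : ∃ u, T u = 0 ∧ P u = 0 ∧ u ≠ 0) :
    ∃ (Q : X →L[ℂ] X) (m : ℕ), Q * Q = Q ∧ Commute T Q ∧ T ^ m * Q = 0 ∧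
      (∀ x, Q x = 0 → P x = 0) ∧ ∃ u, T u = 0 ∧ P u = 0 ∧ Q u ≠ 0 := by
  classical
  have hasc' : ∃ n : ℕ, ∀ x, T x = 0 → P x = 0 →
      x ∈ LinearMap.range (T ^ n).toLinearMap → x = 0 := by
    obtain ⟨n, hn⟩ := hasc
    exact ⟨n, fun x hx _ => hn x hx⟩
  have hp := Nat.find_spec hasc'
  have hmin := fun k => Nat.find_min hasc' (m := k)
  generalize Nat.find hasc' = p at hp hmin
  -- The least exponent `p` is not 0, as `R(T ^ 0)` is everything; for `p = q + 1`, minimality gives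
  -- `u` in `R(T ^ q)` but not in `R(T ^ (q + 1))`.
  obtain _ | q := p
  · obtain ⟨u, hTu, hPu, hu⟩ := hne
    exact absurd (hp u hTu hPu ⟨u, by simp⟩) hu
  have hq := hmin q (Nat.lt_succ_self q)
  push Not at hq
  obtain ⟨u, hTu, hPu, ⟨w, hw⟩, hu⟩ := hq
  have hu' : u ∉ LinearMap.range (T ^ (q + 1)).toLinearMap := fun h => hu (hp u hTu hPu h)
  have hw' : (T ^ q) w = u := hw
  have hPP : ∀ x, P (P x) = P x := fun x => congrArg (fun S : X →L[ℂ] X => S x) hP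
  have hpow : ∀ k x, P ((T ^ k) x) = (T ^ k) (P x) := fun k x =>
    congrArg (fun S : X →L[ℂ] X => S x) (hTP.pow_left k).symm.eq
  obtain ⟨f₀, hf₀u, hf₀⟩ := exists_functional (hcl (q + 1)) hu'
  -- Composing with `1 - P` makes the functional vanish on `R(P)`, so the new projection is
  -- orthogonal to `P`.
  let f : X →L[ℂ] ℂ := f₀.comp (1 - P)
  have hf : ∀ x, f x = f₀ (x - P x) := fun x => rfl
  have hfu : f u = 1 := by rw [hf, hPu, sub_zero, hf₀u]
  obtain ⟨y, hy, hPy, hfy⟩ := exists_dual_chain hTP hfu hTu (x := w - P w)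
    (by rw [map_sub, ← hpow, hw', hPu, sub_zero]) (by rw [map_sub, hPP, sub_self])
  obtain ⟨B, hBB, hTB, hTB0, hBP, hPB, hBu⟩ := exists_chain_projection hTP
    (by rw [pow_succ', mul_apply_eq_comp, hy, hTu]) hPy (by rw [hy, hfu]) hfy
    (fun x => by
      rw [hf, hpow, ← map_sub]
      exact hf₀ _ ⟨_, rfl⟩)
    (fun x => by rw [hf, hPP, sub_self, map_zero])
  refine ⟨P + B, n + (q + 1), ?_, hTP.add_right hTB, ?_, fun x hx => ?_, u, hTu, hPu, ?_⟩
  · rw [add_mul, mul_add, mul_add, hP, hBB, hBP, hPB, add_zero, zero_add]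
  · rw [mul_add, pow_add, mul_assoc _ _ B, hTB0, mul_zero, add_zero, ← pow_add, add_comm,
      pow_add, mul_assoc, hn, mul_zero]
  · have h1 : P ((P + B) x) = P x := by
      have : P * (P + B) = P := by rw [mul_add, hP, hPB, add_zero]
      exact congrArg (fun S : X →L[ℂ] X => S x) this
    rw [← h1, hx, map_zero]
  · rw [add_apply, hPu, zero_add, ← hy, hBu, hy]
    exact hu

/-- A bounded operator with finite-dimensional kernel, finite ascent and closed ranges is the
direct sum of a nilpotent operator and an injective one. -/
theorem exists_nilpotent_projection {T : X →L[ℂ] X}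
    (hfin : FiniteDimensional ℂ (LinearMap.ker T.toLinearMap))
    (hcl : ∀ n : ℕ, IsClosed ((LinearMap.range (T ^ n).toLinearMap : Submodule ℂ X) : Set X))
    (hasc : ∃ n : ℕ, ∀ x, T x = 0 → x ∈ LinearMap.range (T ^ n).toLinearMap → x = 0) :
    ∃ (P : X →L[ℂ] X) (n : ℕ), P * P = P ∧ Commute T P ∧ T ^ n * P = 0 ∧
      ∀ x, T x = 0 → P x = 0 → x = 0 := by
  -- Strong induction on `dim (N(T) ∩ N(P))`, which drops strictly with each absorbed chain; it
  -- starts from `P = 0`.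
  have key : ∀ (d : ℕ) (P : X →L[ℂ] X) (n : ℕ), P * P = P → Commute T P → T ^ n * P = 0 →
      Module.finrank ℂ
        (LinearMap.ker T.toLinearMap ⊓ LinearMap.ker P.toLinearMap : Submodule ℂ X) = d →
      ∃ (P : X →L[ℂ] X) (n : ℕ), P * P = P ∧ Commute T P ∧ T ^ n * P = 0 ∧
        ∀ x, T x = 0 → P x = 0 → x = 0 := by
    intro d
    induction d using Nat.strong_induction_on with
    | _ d ih =>
      intro P n hP hTP hn hd
      by_cases hne : ∃ u, T u = 0 ∧ P u = 0 ∧ u ≠ 0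
      · obtain ⟨Q, m, hQ, hTQ, hm, hle, u, hTu, hPu, hQu⟩ :=
          exists_larger_projection hcl hasc hP hTP hn hne
        refine ih _ ?_ Q m hQ hTQ hm rfl
        rw [← hd]
        have : FiniteDimensional ℂ
            (LinearMap.ker T.toLinearMap ⊓ LinearMap.ker P.toLinearMap : Submodule ℂ X) :=
          Submodule.finiteDimensional_inf_left _ _
        have hmem : u ∈ LinearMap.ker T.toLinearMap ⊓ LinearMap.ker P.toLinearMap := ⟨hTu, hPu⟩
        exact Submodule.finrank_lt_finrank_of_lt (SetLike.lt_iff_le_and_exists.2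
          ⟨fun x hx => ⟨hx.1, hle x hx.2⟩, u, hmem, fun h => hQu (Submodule.mem_inf.1 h).2⟩)
      · push Not at hne
        exact ⟨P, n, hP, hTP, hn, hne⟩
  exact key _ 0 0 (mul_zero 0) (Commute.zero_right T) (mul_zero _) rfl

/-! ### Recovering left generalized Drazin invertibility. -/

/-- `E` maps `H₀(T)` into itself and into `R(E)`, where `T` is bounded below and so has trivial
quasi-nilpotent part. Hence `H₀(T) = N(E)`, which is closed with complement `R(E)`. -/
theorem isLeftGeneralizedDrazinInvertible_of_idempotent [CompleteSpace X] {T E : X →L[ℂ] X}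
    (hE : ∀ x, E (E x) = E x) (hTE : ∀ x, E (T x) = T (E x))
    (hker : ∀ x, E x = 0 → x ∈ quasinilpotentPart T)
    (hinj : ∀ x, E x = x → T x = 0 → x = 0) (hcl : IsClosed (T '' {x | E x = x})) :
    IsLeftGeneralizedDrazinInvertible T := by
  let M : Submodule ℂ X := LinearMap.eqLocus E.toLinearMap LinearMap.id
  have hMset : (M : Set X) = {x | E x = x} := rfl
  have hMcl : IsClosed (M : Set X) := isClosed_eq E.continuous continuous_id
  have hM : MapsTo T M M := fun x hx => by
    have hx' : E x = x := hx
    change E (T x) = T x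
    rw [hTE, hx']
  obtain ⟨c, hc, hbd⟩ := exists_bounded_below hMcl hinj (by rwa [hMset])
  have hH : ∀ x, x ∈ quasinilpotentPart T ↔ E x = 0 := fun x =>
    ⟨fun hx => eq_zero_of_bounded_below hM hc hbd (hE x) (map_mem_quasinilpotentPart E hTE hx),
      hker x⟩
  refine ⟨?_, M, hM, hMcl, ?_, by rwa [hMset]⟩
  · have : (quasinilpotentPart T : Set X) = {x | E x = 0} := Set.ext hH
    rw [this]
    exact isClosed_eq E.continuous continuous_const
  · refine IsCompl.of_eq ((Submodule.eq_bot_iff _).2 ?_) (eq_top_iff.2 fun x _ => ?_)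
    · rintro x ⟨hx, hx'⟩
      have h1 : E x = x := hx'
      rw [← h1, (hH x).1 hx]
    · refine Submodule.mem_sup.2 ⟨x - E x, hker _ ?_, E x, hE x, by abel⟩
      rw [map_sub, hE, sub_self]

theorem HasSVEPAt.restrict {T : X →L[ℂ] X} {l : ℂ} (h : HasSVEPAt T l) {M : Submodule ℂ X}
    (hM : MapsTo T M M) : HasSVEPAt (T.restrict hM) l := by
  intro U hU hc hl f hf hTf z hz
  refine Subtype.ext (h U hU hc hl (fun w => M.subtypeL (f w))
    (fun w hw => (M.subtypeL.analyticAt _).comp (hf w hw)) (fun w hw => ?_) z hz)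
  exact congrArg Subtype.val (hTf w hw)

theorem IsPseudoUpperSemiBFredholm.isLeftGeneralizedDrazinInvertible [CompleteSpace X]
    {T : X →L[ℂ] X} (h : IsPseudoUpperSemiBFredholm T) (hs : HasSVEPAt T 0) :
    IsLeftGeneralizedDrazinInvertible T := by
  obtain ⟨X₁, X₂, h₁, h₂, hc₁, hc₂, hcompl, hF, hQ⟩ := h
  have := hc₁.completeSpace_coe
  have := hc₂.completeSpace_coe
  obtain ⟨P, n, hP, hTP, hn, hinj⟩ := exists_nilpotent_projection hF.1 hF.isClosed_range_pow
    (hF.exists_ker_inf_range_pow_eq_bot (hs.restrict h₁))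
  set T₁ := T.restrict h₁ with hT₁
  have hPP : ∀ x, P (P x) = P x := fun x => congrArg (fun S : X₁ →L[ℂ] X₁ => S x) hP
  have hPT : ∀ x, P (T₁ x) = T₁ (P x) := fun x =>
    congrArg (fun S : X₁ →L[ℂ] X₁ => S x) hTP.symm.eq
  let π : X →L[ℂ] X₁ := X₁.projectionOntoL X₂
    (Submodule.IsCompl.isTopCompl_of_isClosed hcompl hc₁ hc₂)
  have hπ₁ : ∀ x : X₁, π x = x := fun x => Submodule.projectionOnto_apply_left hcompl x
  have hπ₂ : ∀ x ∈ X₂, π x = 0 := fun x hx =>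
    (Submodule.projectionOnto_apply_eq_zero_iff hcompl).2 hx
  have hsub : ∀ x, x - π x ∈ X₂ := fun x => by
    rw [← Submodule.projectionOnto_apply_eq_zero_iff hcompl]
    change π (x - π x) = 0
    rw [map_sub, hπ₁, sub_self]
  have hπT : ∀ x, π (T x) = T₁ (π x) := by
    intro x
    have h3 : T x = (T₁ (π x) : X₁) + T (x - π x) := by
      rw [map_sub, hT₁, restrict_coe]
      abel
    rw [h3, map_add, hπ₁, hπ₂ _ (h₂ (hsub x)), add_zero]
  -- The projection onto the injective part of `T₁`, along the nilpotent part plus `X₂`.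
  let E : X →L[ℂ] X := X₁.subtypeL.comp ((1 - P).comp π)
  have hE : ∀ x, E x = ((π x - P (π x) : X₁) : X) := fun x => rfl
  have hfix : ∀ x, E x = x ↔ ∃ y : X₁, P y = 0 ∧ (y : X) = x := by
    intro x
    constructor
    · intro hx
      exact ⟨π x - P (π x), by rw [map_sub, hPP, sub_self], by rw [← hE, hx]⟩
    · rintro ⟨y, hy, rfl⟩
      rw [hE, hπ₁, hy, sub_zero]
  refine isLeftGeneralizedDrazinInvertible_of_idempotent (E := E) ?_ ?_ ?_ ?_ ?_
  · intro x
    exact (hfix _).2 ⟨π x - P (π x), by rw [map_sub, hPP, sub_self], rfl⟩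
  · intro x
    rw [hE, hE, hπT, hPT, ← map_sub, hT₁, restrict_coe]
  · intro x hx
    have hPx : P (π x) = π x := by
      rw [hE] at hx
      exact (sub_eq_zero.1 (Subtype.ext hx)).symm
    have hx₁ : π x ∈ quasinilpotentPart T₁ := by
      have h0 : ∀ k, n ≤ k → (T₁ ^ k) (π x) = 0 := by
        intro k hk
        obtain ⟨m, rfl⟩ := Nat.exists_eq_add_of_le' hk
        rw [← hPx, ← mul_apply_eq_comp, pow_add, mul_assoc, hn, mul_zero,
          zero_apply]
      refine tendsto_const_nhds.congr' ?_
      -- The extra 1 excludes `k = 0`, where `1 / k = 0` and `0 ^ 0 = 1`.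
      filter_upwards [eventually_ge_atTop (n + 1)] with k hk
      have : (1 / (k : ℝ)) ≠ 0 := by
        have : (0 : ℝ) < k := by exact_mod_cast (by omega : 0 < k)
        positivity
      rw [h0 k (by omega), norm_zero, Real.zero_rpow this]
    have hx₂ := mem_quasinilpotentPart_of_isQuasinilpotent hQ ⟨x - π x, hsub x⟩
    have h4 := add_mem (map_mem_quasinilpotentPart (T' := T) X₁.subtypeL (fun _ => rfl) hx₁)
      (map_mem_quasinilpotentPart (T' := T) X₂.subtypeL (fun _ => rfl) hx₂)
    simpa using h4
  · intro x hx hTx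
    obtain ⟨y, hy, rfl⟩ := (hfix x).1 hx
    rw [hinj y (Subtype.ext hTx) hy, Submodule.coe_zero]
  -- Since `E` commutes with `T`, the image of `R(E)` is the intersection of two closed sets, `R(E)`
  -- and `R(T₁)`.
  · have himg : T '' {x | E x = x} = {y | E y = y} ∩ Subtype.val '' (range T₁) := by
      ext z
      constructor
      · rintro ⟨x, hx, rfl⟩
        obtain ⟨y, hy, rfl⟩ := (hfix x).1 hx
        exact ⟨(hfix _).2 ⟨T₁ y, by rw [hPT, hy, map_zero], rfl⟩, T₁ y, ⟨y, rfl⟩, rfl⟩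
      · rintro ⟨hz, _, ⟨y, rfl⟩, rfl⟩
        have hz' : E (T₁ y) = T₁ y := hz
        refine ⟨E y, (hfix _).2 ⟨y - P y, by rw [map_sub, hPP, sub_self], by
          rw [hE, hπ₁]⟩, ?_⟩
        rw [← hz', hE, hE, hπ₁, hπ₁, hPT, ← map_sub, hT₁, restrict_coe]
    rw [himg]
    exact (isClosed_eq E.continuous continuous_id).inter
      (hc₁.isClosedEmbedding_subtypeVal.isClosedMap _ hF.2)

theorem IsPseudoUpperSemiBWeyl.isPseudoUpperSemiBFredholm {T : X →L[ℂ] X}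
    (h : IsPseudoUpperSemiBWeyl T) : IsPseudoUpperSemiBFredholm T := by
  obtain ⟨X₁, X₂, h₁, h₂, hc₁, hc₂, hcompl, hF, -, hQ⟩ := h
  exact ⟨X₁, X₂, h₁, h₂, hc₁, hc₂, hcompl, hF, hQ⟩

end PseudoBFredholm

theorem mainTheorem1 {X : Type*} [NormedAddCommGroup X] [NormedSpace ℂ X] [CompleteSpace X]
    (T : X →L[ℂ] X) :
    PseudoBFredholm.leftGeneralizedDrazinSpectrum T =
        PseudoBFredholm.pseudoUpperSemiBFredholmSpectrum T ∪ PseudoBFredholm.svepFailureSet T ∧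
      PseudoBFredholm.leftGeneralizedDrazinSpectrum T =
        PseudoBFredholm.pseudoUpperSemiBWeylSpectrum T ∪ PseudoBFredholm.svepFailureSet T := by
  have hW : ∀ l : ℂ, PseudoBFredholm.IsLeftGeneralizedDrazinInvertible
      (T - l • ContinuousLinearMap.id ℂ X) →
      PseudoBFredholm.IsPseudoUpperSemiBWeyl (T - l • ContinuousLinearMap.id ℂ X) ∧
        PseudoBFredholm.HasSVEPAt T l := fun l h =>
    ⟨h.isPseudoUpperSemiBWeyl, PseudoBFredholm.hasSVEPAt_of_translate h.hasSVEPAt_zero⟩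
  have hF : ∀ l : ℂ, PseudoBFredholm.IsPseudoUpperSemiBFredholm
      (T - l • ContinuousLinearMap.id ℂ X) → PseudoBFredholm.HasSVEPAt T l →
      PseudoBFredholm.IsLeftGeneralizedDrazinInvertible (T - l • ContinuousLinearMap.id ℂ X) :=
    fun l h hs => h.isLeftGeneralizedDrazinInvertible (PseudoBFredholm.hasSVEPAt_zero_translate hs)
  have hWF : ∀ l : ℂ, PseudoBFredholm.IsPseudoUpperSemiBWeyl
      (T - l • ContinuousLinearMap.id ℂ X) →
      PseudoBFredholm.IsPseudoUpperSemiBFredholm (T - l • ContinuousLinearMap.id ℂ X) :=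
    fun l h => h.isPseudoUpperSemiBFredholm
  constructor <;> ext l <;>
    simp only [PseudoBFredholm.leftGeneralizedDrazinSpectrum,
      PseudoBFredholm.pseudoUpperSemiBFredholmSpectrum,
      PseudoBFredholm.pseudoUpperSemiBWeylSpectrum, PseudoBFredholm.svepFailureSet,
      mem_ofPred_eq, mem_union] <;>
    have h1 := hW l <;> have h2 := hF l <;> have h3 := hWF l <;> tauto
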